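/- Let $n\ge 0$ and $N\ge 2n$ be integers. Let $E=\mathbb{C}^N\oplus\mathbb{C}^N$ with standard orthonormal bases $e_1,\dots,e_N$ and $f_1,\dots,f_N$ of the two summands, and let $z\colon E\to E$ be the nilpotent endomorphism with $ze_j=e_{j-1}$, $zf_j=f_{j-1}$ for $j\ge 2$ and $ze_1=zf_1=0$. Let $C\colon E\to\mathbb{C}^2$ be the linear map with $C(e_j)=e$, $C(f_j)=f$ for all $j$, where $e,f$ is the standard basis of $\mathbb{C}^2$. Put $E_n=\mathrm{span}(e_1,\dots,e_n,f_1,\dots,f_n)$ and let $z_n\colon E_n\to E_n$ be the restriction of $z$. Let $$Y_{2n}=\{(L_1,\dots,L_{2n}) : 0=L_0\subsetneq L_1\subsetneq\dots\subsetneq L_{2n}\subset E,\ \dim L_j=j,\ zL_j\subset L_j\ \text{for all } j\},$$ which contains the Springer variety $\mathfrak{B}_{n,n}=\{(L_1,\dots,L_{2n})\in Y_{2n} : L_{2n}=E_n\}$. Define $\phi_{2n}\colon Y_{2n}\to(\mathbb{P}^1)^{2n}$ by letting the $j$-th component of $\phi_{2n}(L_1,\dots,L_{2n})$ be the line $C(L_j\cap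 L_{j-1}^{\perp})\subset\mathbb{C}^2$, and define $I_{2n}\colon(\mathbb{P}^1)^{2n}\to(\mathbb{P}^1)^{2n}$ by replacing $l_j$ by its orthogonal complement $l_j^\perp\subset\mathbb{C}^2$ for every even $j$ and keeping $l_j$ for every odd $j$. Let $B^n$ be the set of crossingless matchings of $2n$ points, i.e. of partitions of $\{1,\dots,2n\}$ into pairs such that there are no $i<j<k<l$ with $i$ paired to $k$ and $j$ paired to $l$. For $a\in B^n$ let $O_a$ be the set of the smaller elements of the pairs of $a$, and for $j\in O_a$ let $s_a(j)>j$ be the element paired with $j$ and $d_a(j)=(s_a(j)-j+1)/2$. Put $$K_a=\{(L_1,\dots,L_{2n})\in\mathfrak{B}_{n,n} : L_{s_a(j)}=z_n^{-d_a(j)}L_{j-1}\ \text{for all } j\in O_a\},$$ $$S_a=\{(l_1,\dots,l_{2n})\in(\mathbb{P}^1)^{2n} : l_j=l_{s_a(j)}\ \text{for all } j\in O_a\},\qquad \widetilde S=\bigcup_{a\in B^n}S_a .$$ Then $I_{2n}\circ\phi_{2n}\colon Y_{2n}\to(\mathbb{P}^1)^{2n}$ is a diffeomorphism, it maps $K_a$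 onto $S_a$ for every $a\in B^n$, and it maps $\mathfrak{B}_{n,n}$ onto $\widetilde S$. -/

import Mathlib

open scoped LinearAlgebra.Projectivization ContDiff

noncomputable section

namespace Springer

/-- `E = ℂ^N ⊕ ℂ^N` with its standard hermitian product. The basis vector at `(0, j)` is
`e_{j+1}` and the one at `(1, j)` is `f_{j+1}` (indices in `Fin N` start at `0`). -/
abbrev E (N : ℕ) : Type := EuclideanSpace ℂ (Fin 2 × Fin N)

/-- `ℂ²` with its standard hermitian product; its standard basis is `(e, f)`. -/
abbrev C2 : Type := EuclideanSpace ℂ (Fin 2)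

/-- The complex projective line: complex lines through the origin of `ℂ²`. -/
abbrev P1 : Type := ℙ ℂ C2

/-- The nilpotent endomorphism `z e_j = e_{j-1}`, `z f_j = f_{j-1}`, `z e_1 = z f_1 = 0`,
written in coordinates. -/
def z (N : ℕ) : E N →ₗ[ℂ] E N where
  toFun v := WithLp.toLp 2 fun p =>
    if h : (p.2 : ℕ) + 1 < N then v (p.1, ⟨(p.2 : ℕ) + 1, h⟩) else 0
  map_add' v w := by
    ext p
    by_cases h : (p.2 : ℕ) + 1 < N <;> simp [h]
  map_smul' c v := by
    ext p
    by_cases h : (p.2 : ℕ) + 1 < N <;> simp [h]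

/-- The linear map `C e_j = e`, `C f_j = f`, written in coordinates. -/
def C (N : ℕ) : E N →ₗ[ℂ] C2 where
  toFun v := WithLp.toLp 2 fun k => ∑ j : Fin N, v (k, j)
  map_add' v w := by
    ext k
    simp [Finset.sum_add_distrib]
  map_smul' c v := by
    ext k
    simp [Finset.mul_sum]

/-- `E_n = span(e_1, …, e_n) ⊕ span(f_1, …, f_n)`, as a subspace of `E`. -/
def En (N n : ℕ) : Submodule ℂ (E N) :=
  Submodule.span ℂ
    {v | ∃ (k : Fin 2) (j : Fin N), (j : ℕ) < n ∧ v = EuclideanSpace.single (k, j) (1 : ℂ)}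

/-- Flags `0 = L_0 ⊊ L_1 ⊊ … ⊊ L_m ⊆ E` with `dim L_j = j` and `z L_j ⊆ L_j` for all `j`. -/
@[ext]
structure Y (N m : ℕ) where
  L : Fin (m + 1) → Submodule ℂ (E N)
  strictMono : StrictMono L
  finrank_eq : ∀ j, Module.finrank ℂ (L j) = (j : ℕ)
  stable : ∀ j, (L j).map (z N) ≤ L j

/-! ### The lines `C(L_j ∩ L_{j-1}^⊥)` are one-dimensional -/

lemma z_apply {N : ℕ} (v : E N) (p : Fin 2 × Fin N) :
    z N v p = if h : (p.2 : ℕ) + 1 < N then v (p.1, ⟨(p.2 : ℕ) + 1, h⟩) else 0 := rfl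

lemma C_apply {N : ℕ} (v : E N) (k : Fin 2) : C N v k = ∑ j : Fin N, v (k, j) := rfl

lemma z_pow_apply {N : ℕ} (d : ℕ) (v : E N) (p : Fin 2 × Fin N) :
    (z N ^ d) v p = if h : (p.2 : ℕ) + d < N then v (p.1, ⟨(p.2 : ℕ) + d, h⟩) else 0 := by
  induction d generalizing v with
  | zero => simp
  | succ d ih =>
    rw [pow_succ, Module.End.mul_apply, ih]
    by_cases h : (p.2 : ℕ) + d < N
    · rw [dif_pos h, z_apply]
      rfl
    · rw [dif_neg h, dif_neg (by omega)]

lemma z_pow_eq_zero (N : ℕ) : z N ^ N = 0 := by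
  ext v p
  rw [z_pow_apply, dif_neg (by omega)]
  rfl

/-- `z` maps `L_j` to `L_{j-1}`. -/
lemma Y.z_mem {N m : ℕ} (F : Y N m) (j : Fin m) {v : E N} (hv : v ∈ F.L j.succ) :
    z N v ∈ F.L j.castSucc := by
  have hst : ∀ (i : Fin (m + 1)) {w : E N}, w ∈ F.L i → z N w ∈ F.L i := fun i w hw =>
    F.stable i (Submodule.mem_map_of_mem hw)
  by_contra hz
  have hle : F.L j.castSucc ⊔ Submodule.span ℂ {z N v} ≤ F.L j.succ :=
    sup_le (F.strictMono.monotone (Fin.castSucc_lt_succ).le)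
      ((Submodule.span_singleton_le_iff_mem _ _).2 (hst _ hv))
  have hlt : F.L j.castSucc < F.L j.castSucc ⊔ Submodule.span ℂ {z N v} := by
    refine lt_of_le_of_ne le_sup_left fun h => hz ?_
    rw [h]
    exact (le_sup_right : _ ≤ F.L j.castSucc ⊔ Submodule.span ℂ {z N v})
      (Submodule.mem_span_singleton_self _)
  have heq := Submodule.eq_of_le_of_finrank_le hle (by
    have := Submodule.finrank_lt_finrank_of_lt hlt
    rw [F.finrank_eq] at this ⊢
    simpa using this)
  rw [← heq] at hv
  obtain ⟨w, hw, y, hy, hwy⟩ := Submodule.mem_sup.1 hv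
  obtain ⟨c, rfl⟩ := Submodule.mem_span_singleton.1 hy
  have key : ∀ k : ℕ, ∃ w' ∈ F.L j.castSucc, ∃ c' : ℂ, v = w' + c' • (z N ^ k) v := by
    intro k
    induction k with
    | zero => exact ⟨0, zero_mem _, 1, by simp⟩
    | succ k ih =>
      obtain ⟨w', hw', c', h⟩ := ih
      refine ⟨w + c • z N w', add_mem hw (Submodule.smul_mem _ _ (hst _ hw')), c * c', ?_⟩
      have h' : z N v = z N w' + c' • (z N ^ (k + 1)) v := by
        conv_lhs => rw [h]
        rw [map_add, map_smul, pow_succ', Module.End.mul_apply]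
      conv_lhs => rw [← hwy, h']
      rw [smul_add, smul_smul, add_assoc]
  obtain ⟨w', hw', c', h⟩ := key N
  rw [z_pow_eq_zero, LinearMap.zero_apply, smul_zero, add_zero] at h
  exact hz (hst _ (h ▸ hw'))

/-- The restriction of `C` to `L_j ∩ L_{j-1}^⊥` is injective. -/
lemma Y.C_injOn {N m : ℕ} (F : Y N m) (j : Fin m) {v : E N} (hv : v ∈ F.L j.succ)
    (hv' : v ∈ (F.L j.castSucc)ᗮ) (h : C N v = 0) : v = 0 := by
  obtain _ | M := N
  · ext p
    exact p.2.elim0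
  set u : E (M + 1) := ∑ d ∈ Finset.range (M + 1), (z (M + 1) ^ d) v with hu
  have hst : ∀ d : ℕ, (z (M + 1) ^ (d + 1)) v ∈ F.L j.castSucc := by
    intro d
    induction d with
    | zero => simpa using F.z_mem j hv
    | succ d ih =>
      rw [pow_succ', Module.End.mul_apply]
      exact F.stable _ (Submodule.mem_map_of_mem ih)
  have hzu : z (M + 1) u = ∑ d ∈ Finset.range (M + 1), (z (M + 1) ^ (d + 1)) v := by
    rw [hu, map_sum]
    exact Finset.sum_congr rfl fun d _ => by rw [pow_succ', Module.End.mul_apply]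
  have hmem : z (M + 1) u ∈ F.L j.castSucc := hzu ▸ Submodule.sum_mem _ fun d _ => hst d
  have huv : u = z (M + 1) u + v := by
    rw [hzu, Finset.sum_range_succ, z_pow_eq_zero, LinearMap.zero_apply, add_zero, hu,
      Finset.sum_range_succ', pow_zero, Module.End.one_apply]
  have hu0 : ∀ k, u (k, 0) = 0 := by
    intro k
    have hk : C (M + 1) v k = 0 := by rw [h]; rfl
    rw [C_apply] at hk
    rw [hu, WithLp.ofLp_sum, Finset.sum_apply, Finset.sum_range, ← hk]
    refine Finset.sum_congr rfl fun d _ => ?_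
    rw [z_pow_apply, dif_pos (by simpa using d.is_le)]
    simp
  have hnorm : ‖z (M + 1) u‖ ^ 2 = ‖u‖ ^ 2 := by
    rw [EuclideanSpace.norm_sq_eq, EuclideanSpace.norm_sq_eq, Fintype.sum_prod_type,
      Fintype.sum_prod_type]
    refine Finset.sum_congr rfl fun k _ => ?_
    rw [Fin.sum_univ_castSucc, Fin.sum_univ_succ, hu0]
    simp [z_apply, Fin.succ]
  have hin : inner ℂ (z (M + 1) u) v = 0 := Submodule.inner_right_of_mem_orthogonal hmem hv'
  have hadd := @norm_add_sq ℂ _ _ _ _ (z (M + 1) u) v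
  rw [← huv, hin, hnorm] at hadd
  have : ‖v‖ ^ 2 = 0 := by simpa using hadd
  simpa using this

lemma Y.finrank_line {N m : ℕ} (F : Y N m) (j : Fin m) :
    Module.finrank ℂ ((F.L j.succ ⊓ (F.L j.castSucc)ᗮ).map (C N)) = 1 := by
  have hle : F.L j.castSucc ≤ F.L j.succ := F.strictMono.monotone (Fin.castSucc_lt_succ).le
  have h1 := Submodule.finrank_add_inf_finrank_orthogonal hle
  rw [F.finrank_eq, F.finrank_eq, inf_comm] at h1
  have h2 : Module.finrank ℂ ↥(F.L j.succ ⊓ (F.L j.castSucc)ᗮ) = 1 := by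
    simp at h1; omega
  rw [← h2]
  refine (LinearEquiv.finrank_eq (LinearEquiv.ofBijective
    ((C N).submoduleMap (F.L j.succ ⊓ (F.L j.castSucc)ᗮ)) ⟨?_, ?_⟩)).symm
  · rw [injective_iff_map_eq_zero]
    rintro ⟨v, hv⟩ h
    have := F.C_injOn j hv.1 hv.2 (congrArg Subtype.val h)
    exact Subtype.ext this
  · exact LinearMap.submoduleMap_surjective _ _

/-- `φ_m(L_1, …, L_m) = (C(L_1), C(L_2 ∩ L_1^⊥), …, C(L_m ∩ L_{m-1}^⊥))`. -/
def phi (N m : ℕ) (F : Y N m) : Fin m → P1 := fun j =>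
  Projectivization.mk'' ((F.L j.succ ⊓ (F.L j.castSucc)ᗮ).map (C N)) (F.finrank_line j)

lemma finrank_perp (l : P1) : Module.finrank ℂ (l.submodule)ᗮ = 1 := by
  have h := Submodule.finrank_add_finrank_orthogonal l.submodule
  rw [Projectivization.finrank_submodule, finrank_euclideanSpace_fin] at h
  omega

/-- The orthogonal complement of a complex line in `ℂ²`. -/
def perp (l : P1) : P1 := Projectivization.mk'' (l.submodule)ᗮ (finrank_perp l)

/-- `I_m` replaces `l_j` by `l_j^⊥` for even `j`; the factor with index `j : Fin m` is the
`(j+1)`-st one. -/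
def I (m : ℕ) (l : Fin m → P1) : Fin m → P1 := fun j =>
  if Even ((j : ℕ) + 1) then perp (l j) else l j

/-- Crossingless matchings of `2n` points: partitions of the set of points into pairs, given by
the fixed point free involution that sends a point to its partner, such that there are no
`i < j < k < l` with `i` paired to `k` and `j` paired to `l`. -/
@[ext]
structure Matching (n : ℕ) where
  s : Fin (2 * n) → Fin (2 * n)
  involutive : Function.Involutive s
  ne_self : ∀ i, s i ≠ i
  crossingless : ¬ ∃ i j k l, i < j ∧ j < k ∧ k < l ∧ s i = k ∧ s j = l

/-- The set of left endpoints of the pairs of a matching. -/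
def Matching.O {n : ℕ} (a : Matching n) : Set (Fin (2 * n)) := {i | i < a.s i}

/-- `d_a(i) = (s_a(i) - i + 1) / 2`, for `i ∈ O_a`. -/
def Matching.d {n : ℕ} (a : Matching n) (i : Fin (2 * n)) : ℕ := ((a.s i : ℕ) - (i : ℕ) + 1) / 2

/-- The Springer variety `𝔅_{n,n}`: the flags in `Y_{2n}` with `L_{2n} = E_n`. -/
def B (N n : ℕ) : Set (Y N (2 * n)) := {F | F.L (Fin.last (2 * n)) = En N n}

/-- `z_n^{-d} W`, the preimage of `W` under the `d`-th power of the restriction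
`z_n : E_n → E_n` of `z`. -/
def zPre (N n d : ℕ) (W : Submodule ℂ (E N)) : Submodule ℂ (E N) := En N n ⊓ W.comap (z N ^ d)

/-- The component `K_a` of `𝔅_{n,n}`: the flags with `L_{s_a(j)} = z_n^{-d_a(j)} L_{j-1}` for all
`j ∈ O_a`. The point `j : Fin (2 * n)` is the `(j+1)`-st one, so `L_{s_a(j)}` is
`L (a.s j).succ` and `L_{j-1}` is `L j.castSucc`. -/
def K (N : ℕ) {n : ℕ} (a : Matching n) : Set (Y N (2 * n)) :=
  {F | F ∈ B N n ∧ ∀ j ∈ a.O, F.L (a.s j).succ = zPre N n (a.d j) (F.L j.castSucc)}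

/-- `S_a`: the tuples of lines with `l_j = l_{s_a(j)}` for all `j ∈ O_a`. -/
def S {n : ℕ} (a : Matching n) : Set (Fin (2 * n) → P1) := {l | ∀ j ∈ a.O, l j = l (a.s j)}

/-- `S̃`, the union of all `S_a`. -/
def STilde (n : ℕ) : Set (Fin (2 * n) → P1) := ⋃ a : Matching n, S a

/-! ### Diffeomorphisms

A Grassmannian is a smooth submanifold of a real vector space of endomorphisms, a subspace being
identified with the orthogonal projection onto it. In this way `Y_m` and `(ℙ¹)^m` are subsets of
finite-dimensional real vector spaces, and a map between such subsets is smooth if it extends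
locally to a smooth map between the vector spaces. -/

/-- A flag as a tuple of orthogonal projections. -/
def flagProj (N m : ℕ) (F : Y N m) : Fin (m + 1) → (E N →L[ℂ] E N) := fun j =>
  (F.L j).starProjection

/-- A tuple of lines as a tuple of orthogonal projections. -/
def lineProj (m : ℕ) (l : Fin m → P1) : Fin m → (C2 →L[ℂ] C2) := fun j =>
  (l j).submodule.starProjection

/-- Smoothness of `f : A → B`, where `ι` and `κ` realize `A` and `B` as subsets of real normed
spaces: near each point of `A`, `f` is the restriction of a smooth map defined on an open set. -/
def IsSmooth {A B V W : Type*} [NormedAddCommGroup V] [NormedSpace ℝ V] [NormedAddCommGroup W]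
    [NormedSpace ℝ W] (ι : A → V) (κ : B → W) (f : A → B) : Prop :=
  ∀ a, ∃ (U : Set V) (G : V → W), IsOpen U ∧ ι a ∈ U ∧ ContDiffOn ℝ ∞ G U ∧
    ∀ a', ι a' ∈ U → G (ι a') = κ (f a')

/-- `f` is a bijection that is smooth in both directions. -/
def IsDiffeo {A B V W : Type*} [NormedAddCommGroup V] [NormedSpace ℝ V] [NormedAddCommGroup W]
    [NormedSpace ℝ W] (ι : A → V) (κ : B → W) (f : A → B) : Prop :=
  IsSmooth ι κ f ∧
    ∃ g : B → A, Function.LeftInverse g f ∧ Function.RightInverse g f ∧ IsSmooth κ ι g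

end Springer

end

/-
For a `z`-stable subspace `L`, the map `C` is isometric on `z⁻¹ L ∩ L^⊥`. Hence a `z`-stable flag is
determined by its layers `C(L_j ∩ L_{j-1}^⊥)`, which may be prescribed freely, and in terms of
orthogonal projections both directions of this correspondence are polynomial.

Taking preimages under `z` does not change layers, and the layer of `z⁻¹ L` over a subspace `L'`
between `L` and `z⁻¹ L` is the orthogonal complement of the layer of `L'` over `L`. If the points
strictly inside an arc `{i, t}` are matched among themselves, then `L_{t-1}` is the preimage of
`L_i` under a power of `z`, and the relation imposed by the arc says precisely that the lines `i`
and `t` are orthogonal complements of each other. As `t - i` is odd, `I` turns this into equality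
of the two lines.

For a flag ending in `E_n`, the first step that contains `ker z` has the form `z⁻¹ L_j`, so the two
lines adjacent there are complementary. Omitting them replaces the end `ker z^n` of the flag by
`ker z^(n-1)`, and induction yields a matching.
-/

noncomputable section

namespace Springer

section IsometricOn

variable {𝕜 V W : Type*} [RCLike 𝕜] [NormedAddCommGroup V] [InnerProductSpace 𝕜 V]
  [NormedAddCommGroup W] [InnerProductSpace 𝕜 W] {f : V →ₗ[𝕜] W} {A D : Submodule 𝕜 V}

/-- `f` preserves the norm of every vector of `D`. A linear map with `IsIsometricOn f (ker f)ᗮ` is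
a partial isometry. -/
def IsIsometricOn (f : V →ₗ[𝕜] W) (D : Submodule 𝕜 V) : Prop := ∀ v ∈ D, ‖f v‖ = ‖v‖

namespace IsIsometricOn

lemma mono (h : IsIsometricOn f D) (hA : A ≤ D) : IsIsometricOn f A := fun v hv => h v (hA hv)

lemma inner_map_map (h : IsIsometricOn f D) {v w : V} (hv : v ∈ D) (hw : w ∈ D) :
    inner 𝕜 (f v) (f w) = inner 𝕜 v w :=
  LinearIsometry.inner_map_map (⟨f.domRestrict D, fun v => h v v.2⟩ : D →ₗᵢ[𝕜] W) ⟨v, hv⟩ ⟨w, hw⟩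

lemma injOn (h : IsIsometricOn f D) : Set.InjOn f D := fun v hv w hw hvw =>
  congrArg Subtype.val <| LinearIsometry.injective
    (⟨f.domRestrict D, fun v => h v v.2⟩ : D →ₗᵢ[𝕜] W) (a₁ := ⟨v, hv⟩) (a₂ := ⟨w, hw⟩) hvw

lemma finrank_map (h : IsIsometricOn f D) :
    Module.finrank 𝕜 (D.map f) = Module.finrank 𝕜 D := by
  rw [← LinearMap.range_domRestrict]
  exact LinearMap.finrank_range_of_inj fun v w hvw => Subtype.ext (h.injOn v.2 w.2 hvw)

lemma inf_comap_map (h : IsIsometricOn f D) (hA : A ≤ D) : D ⊓ (A.map f).comap f = A := by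
  refine le_antisymm ?_ (le_inf hA (Submodule.le_comap_map f A))
  rintro v ⟨hv, a, ha, hav⟩
  exact h.injOn (hA ha) hv hav ▸ ha

lemma map_inf_orthogonal (h : IsIsometricOn f D) (hA : A ≤ D) :
    (D ⊓ Aᗮ).map f = D.map f ⊓ (A.map f)ᗮ := by
  rw [Submodule.map_inf_eq_map_inf_comap]
  congr 1
  ext v
  simp only [Submodule.mem_inf, Submodule.mem_comap, Submodule.mem_orthogonal,
    Submodule.mem_map, forall_exists_index, and_imp, forall_apply_eq_imp_iff₂]
  exact and_congr_right fun hv => forall₂_congr fun a ha => by rw [h.inner_map_map (hA ha) hv]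

variable [FiniteDimensional 𝕜 V] [FiniteDimensional 𝕜 W]

lemma starProjection_map (h : IsIsometricOn f D) (w : W) :
    (D.map f).starProjection w = f (D.starProjection (f.adjoint w)) := by
  have hP := D.starProjection_apply_mem (f.adjoint w)
  refine Submodule.eq_starProjection_of_mem_of_inner_eq_zero (Submodule.mem_map_of_mem hP) ?_
  rintro _ ⟨x, hx, rfl⟩
  rw [inner_sub_left, h.inner_map_map hP hx, ← LinearMap.adjoint_inner_left, ← inner_sub_left]
  exact Submodule.inner_left_of_mem_orthogonal hx (Submodule.sub_starProjection_mem_orthogonal _)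

lemma starProjection_adjoint_apply (h : IsIsometricOn f D) {v : V} (hv : v ∈ D) :
    D.starProjection (f.adjoint (f v)) = v :=
  Submodule.eq_starProjection_of_mem_of_inner_eq_zero hv fun x hx => by
    rw [inner_sub_left, LinearMap.adjoint_inner_left, h.inner_map_map hv hx, sub_self]

lemma starProjection_eq_of_le (h : IsIsometricOn f D) (hA : A ≤ D) (v : V) :
    A.starProjection v =
      D.starProjection (f.adjoint ((A.map f).starProjection (f (D.starProjection v)))) := by
  have hP (x : V) : A.starProjection x = A.starProjection (D.starProjection x) :=
    (congrArg (· x) (Submodule.starProjection_comp_starProjection_of_le hA)).symm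
  rw [(h.mono hA).starProjection_map, hP (f.adjoint _),
    h.starProjection_adjoint_apply (D.starProjection_apply_mem v), ← hP,
    h.starProjection_adjoint_apply (hA (A.starProjection_apply_mem v))]

end IsIsometricOn

section PartialIsometry

variable [FiniteDimensional 𝕜 V] [FiniteDimensional 𝕜 W] {L L' : Submodule 𝕜 W}

lemma apply_adjoint_apply (h : IsIsometricOn f (LinearMap.ker f)ᗮ) (v : V) :
    f (f.adjoint (f v)) = f v := by
  obtain ⟨k, hk, w, hw, rfl⟩ := (LinearMap.ker f).exists_add_mem_mem_orthogonal v
  have hmem : f.adjoint (f w) ∈ (LinearMap.ker f)ᗮ :=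
    f.orthogonal_ker ▸ LinearMap.mem_range_self _ _
  have hadj : f.adjoint (f w) = w :=
    (Submodule.starProjection_eq_self_iff.2 hmem).symm.trans (h.starProjection_adjoint_apply hw)
  rw [map_add, LinearMap.mem_ker.1 hk, zero_add, hadj]

lemma apply_adjoint_of_mem_range (h : IsIsometricOn f (LinearMap.ker f)ᗮ) {w : W}
    (hw : w ∈ LinearMap.range f) : f (f.adjoint w) = w := by
  obtain ⟨v, rfl⟩ := hw
  exact apply_adjoint_apply h v

lemma starProjection_comap (h : IsIsometricOn f (LinearMap.ker f)ᗮ)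
    (hL : L ≤ LinearMap.range f) (v : V) :
    (L.comap f).starProjection v =
      v - f.adjoint (f v) + f.adjoint (L.starProjection (f v)) := by
  have hP := L.starProjection_apply_mem (f v)
  refine Submodule.eq_starProjection_of_mem_of_inner_eq_zero ?_ fun w hw => ?_
  · rwa [Submodule.mem_comap, map_add, map_sub, apply_adjoint_apply h, sub_self, zero_add,
      apply_adjoint_of_mem_range h (hL hP)]
  · rw [← sub_sub, sub_sub_cancel, ← map_sub, LinearMap.adjoint_inner_left]
    exact Submodule.inner_left_of_mem_orthogonal hw
      (Submodule.sub_starProjection_mem_orthogonal _)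

lemma map_comap_inf_orthogonal (h : IsIsometricOn f (LinearMap.ker f)ᗮ)
    (hL : L ≤ LinearMap.range f) (hL' : L' ≤ LinearMap.range f) :
    (L'.comap f ⊓ (L.comap f)ᗮ).map f = L' ⊓ Lᗮ := by
  apply le_antisymm
  · rintro _ ⟨v, ⟨hv, hv'⟩, rfl⟩
    refine ⟨hv, (Submodule.mem_orthogonal _ _).2 fun x hx => ?_⟩
    rw [← LinearMap.adjoint_inner_left]
    refine Submodule.inner_right_of_mem_orthogonal (K := L.comap f) ?_ hv'
    rwa [Submodule.mem_comap, apply_adjoint_of_mem_range h (hL hx)]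
  · rintro u ⟨hu, hu'⟩
    have hfu : f (f.adjoint u) = u := apply_adjoint_of_mem_range h (hL' hu)
    refine ⟨f.adjoint u, ⟨Submodule.mem_comap.2 (hfu.symm ▸ hu), ?_⟩, hfu⟩
    refine (Submodule.mem_orthogonal _ _).2 fun x hx => ?_
    rw [LinearMap.adjoint_inner_right]
    exact Submodule.inner_right_of_mem_orthogonal hx hu'

end PartialIsometry

end IsometricOn

lemma starProjection_sub_starProjection {𝕜 V : Type*} [RCLike 𝕜] [NormedAddCommGroup V]
    [InnerProductSpace 𝕜 V] {L L' : Submodule 𝕜 V} [L.HasOrthogonalProjection]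
    [L'.HasOrthogonalProjection] [(L' ⊓ Lᗮ).HasOrthogonalProjection] (h : L ≤ L') :
    L'.starProjection - L.starProjection = (L' ⊓ Lᗮ).starProjection := by
  ext1 v
  have hL := Submodule.sub_starProjection_mem_orthogonal (K := L) v
  have hL' := Submodule.sub_starProjection_mem_orthogonal (K := L') v
  refine (Submodule.eq_starProjection_of_mem_orthogonal (Submodule.mem_inf.2 ⟨?_, ?_⟩) ?_).symm
  · exact sub_mem (L'.starProjection_apply_mem v) (h (L.starProjection_apply_mem v))
  · simpa using sub_mem hL (Submodule.orthogonal_le h hL')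
  · rw [sub_apply, ← sub_add]
    exact add_mem (Submodule.orthogonal_le inf_le_left hL')
      (Submodule.orthogonal_le inf_le_right
        (Submodule.le_orthogonal_orthogonal _ (L.starProjection_apply_mem v)))

lemma finrank_comap_of_le_range {𝕜 V W : Type*} [DivisionRing 𝕜] [AddCommGroup V] [Module 𝕜 V]
    [FiniteDimensional 𝕜 V] [AddCommGroup W] [Module 𝕜 W] {f : V →ₗ[𝕜] W} {L : Submodule 𝕜 W}
    (hL : L ≤ LinearMap.range f) :
    Module.finrank 𝕜 (L.comap f) = Module.finrank 𝕜 L + Module.finrank 𝕜 (LinearMap.ker f) := by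
  have hker : LinearMap.ker f ≤ L.comap f := Submodule.comap_mono bot_le
  have h := LinearMap.finrank_range_add_finrank_ker (f.domRestrict (L.comap f))
  rw [LinearMap.range_domRestrict, Submodule.map_comap_eq_of_le hL, LinearMap.ker_domRestrict] at h
  rw [← h, ← (Submodule.submoduleOfEquivOfLe hker).finrank_eq]
  rfl

lemma exists_mem_sub_apply_eq {R M : Type*} [Ring R] [AddCommGroup M] [Module R M]
    {f : Module.End R M} (hf : IsNilpotent f) {D : Submodule R M} (hD : D ≤ D.comap f) {v : M}
    (hv : v ∈ D) : ∃ u ∈ D, u - f u = v := by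
  obtain ⟨n, hn⟩ := hf
  refine ⟨(∑ i ∈ Finset.range n, f ^ i) v, ?_, ?_⟩
  · rw [LinearMap.sum_apply]
    exact Submodule.sum_mem _ fun i _ => Module.End.pow_apply_mem_of_forall_mem i hD v hv
  · have h := congrArg (· v) (mul_neg_geom_sum f n)
    simpa [hn] using h

section Shift

variable {N : ℕ} {L L' : Submodule ℂ (E N)}

/-- The coordinates of a vector of `E` along `e_1` and `f_1`, written without coordinates so that it
also makes sense for `N = 0`. -/
def bottom (N : ℕ) : E N →ₗ[ℂ] C2 := C N - C N ∘ₗ z N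

lemma bottom_apply (v : E (N + 1)) (k : Fin 2) : bottom (N + 1) v k = v (k, 0) := by
  change C (N + 1) v k - C (N + 1) (z (N + 1) v) k = v (k, 0)
  rw [C_apply, C_apply, Fin.sum_univ_succ, Fin.sum_univ_castSucc]
  simp [z_apply, Fin.succ]

lemma bottom_eq_C_of_mem_ker {v : E N} (hv : v ∈ LinearMap.ker (z N)) : bottom N v = C N v := by
  simp [bottom, LinearMap.mem_ker.1 hv]

lemma inner_bottom_add_inner_z (v w : E N) :
    inner ℂ (bottom N v) (bottom N w) + inner ℂ (z N v) (z N w) = inner ℂ v w := by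
  obtain _ | M := N
  · simp [Subsingleton.elim v 0]
  simp only [PiLp.inner_apply, Fintype.sum_prod_type, ← Finset.sum_add_distrib]
  refine Finset.sum_congr rfl fun k _ => ?_
  rw [Fin.sum_univ_castSucc, Fin.sum_univ_succ]
  simp [bottom_apply, z_apply, Fin.succ]

lemma norm_sq_bottom_add_norm_sq_z (v : E N) :
    ‖bottom N v‖ ^ 2 + ‖z N v‖ ^ 2 = ‖v‖ ^ 2 := by
  have h := inner_bottom_add_inner_z v v
  simp only [inner_self_eq_norm_sq_to_K] at h
  exact_mod_cast h

lemma map_C_ker_z (hN : 0 < N) : (LinearMap.ker (z N)).map (C N) = ⊤ := by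
  obtain _ | M := N
  · exact absurd hN (lt_irrefl 0)
  refine (Submodule.eq_top_iff').2 fun c => ?_
  refine ⟨WithLp.toLp 2 fun p => if (p.2 : ℕ) = 0 then c p.1 else 0, ?_, ?_⟩
  · refine LinearMap.mem_ker.2 (PiLp.ext fun p => ?_)
    simp [z_apply]
  · ext k
    simp [C_apply]

lemma bottom_eq_zero_of_mem_ker_orthogonal {v : E N} (hv : v ∈ (LinearMap.ker (z N))ᗮ) :
    bottom N v = 0 := by
  rcases N.eq_zero_or_pos with rfl | hN
  · simp [Subsingleton.elim v 0]
  obtain ⟨w, hw, hwv⟩ : bottom N v ∈ (LinearMap.ker (z N)).map (C N) := map_C_ker_z hN ▸ trivial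
  have h := inner_bottom_add_inner_z w v
  rw [bottom_eq_C_of_mem_ker hw, hwv, LinearMap.mem_ker.1 hw, inner_zero_left, add_zero,
    Submodule.inner_right_of_mem_orthogonal hw hv] at h
  exact inner_self_eq_zero.1 h

lemma C_z_of_mem_ker_orthogonal {v : E N} (hv : v ∈ (LinearMap.ker (z N))ᗮ) :
    C N (z N v) = C N v :=
  (sub_eq_zero.1 (bottom_eq_zero_of_mem_ker_orthogonal hv)).symm

lemma isIsometricOn_z_ker_orthogonal : IsIsometricOn (z N) (LinearMap.ker (z N))ᗮ := by
  intro v hv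
  have h := norm_sq_bottom_add_norm_sq_z v
  rw [bottom_eq_zero_of_mem_ker_orthogonal hv, norm_zero, zero_pow two_ne_zero, zero_add] at h
  exact (sq_eq_sq₀ (norm_nonneg _) (norm_nonneg _)).1 h

/- Write `v = u - z u` with `z u ∈ L`. Then `C v = bottom u`, and computing `‖u‖²` from
`u = z u + v` and from the coordinates of `u` gives `‖v‖² = ‖u‖² - ‖z u‖² = ‖bottom u‖²`. -/
lemma isIsometricOn_C (hL : L ≤ L.comap (z N)) : IsIsometricOn (C N) (L.comap (z N) ⊓ Lᗮ) := by
  rintro v ⟨hv, hv'⟩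
  obtain ⟨u, hu, rfl⟩ :=
    exists_mem_sub_apply_eq ⟨N, z_pow_eq_zero N⟩ (Submodule.comap_mono hL) hv
  have hC : C N (u - z N u) = bottom N u := map_sub (C N) u (z N u)
  have horth := norm_add_sq_eq_norm_sq_add_norm_sq_of_inner_eq_zero (𝕜 := ℂ)
    (z N u) (u - z N u) (Submodule.inner_right_of_mem_orthogonal hu hv')
  have hnorm := norm_sq_bottom_add_norm_sq_z u
  rw [add_sub_cancel] at horth
  rw [hC, ← sq_eq_sq₀ (norm_nonneg _) (norm_nonneg _)]
  nlinarith

lemma finrank_ker_z (hN : 0 < N) : Module.finrank ℂ (LinearMap.ker (z N)) = 2 := by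
  have h := (isIsometricOn_C (L := (⊥ : Submodule ℂ (E N))) bot_le).finrank_map
  rw [Submodule.bot_orthogonal_eq_top, inf_top_eq, Submodule.comap_bot, map_C_ker_z hN,
    finrank_top, finrank_euclideanSpace_fin] at h
  exact h.symm

lemma finrank_comap_z (hN : 0 < N) (hr : L ≤ LinearMap.range (z N)) :
    Module.finrank ℂ (L.comap (z N)) = Module.finrank ℂ L + 2 := by
  rw [finrank_comap_of_le_range hr, finrank_ker_z hN]

lemma map_C_comap_z_inf_orthogonal (hN : 0 < N) (hL : L ≤ L.comap (z N))
    (hr : L ≤ LinearMap.range (z N)) : (L.comap (z N) ⊓ Lᗮ).map (C N) = ⊤ := by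
  have hdim := Submodule.finrank_add_inf_finrank_orthogonal hL
  rw [finrank_comap_z hN hr, inf_comm, ← (isIsometricOn_C hL).finrank_map] at hdim
  exact Submodule.eq_top_of_finrank_eq (by rw [finrank_euclideanSpace_fin]; omega)

lemma mem_ker_z_pow {d : ℕ} {v : E N} :
    v ∈ LinearMap.ker (z N ^ d) ↔ ∀ p : Fin 2 × Fin N, d ≤ (p.2 : ℕ) → v p = 0 := by
  rw [LinearMap.mem_ker]
  refine ⟨fun h p hp => ?_, fun h => PiLp.ext fun p => ?_⟩
  · have hv := congrArg (fun u : E N => u (p.1, ⟨(p.2 : ℕ) - d, by omega⟩)) h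
    simpa [z_pow_apply, Nat.sub_add_cancel hp] using hv
  · rw [z_pow_apply]
    split_ifs with hp
    exacts [h _ (Nat.le_add_left d p.2), rfl]

lemma ker_z_pow_le_range {d : ℕ} (hd : d < N) :
    LinearMap.ker (z N ^ d) ≤ LinearMap.range (z N) := by
  intro v hv
  refine ⟨WithLp.toLp 2 fun p => v (p.1, ⟨(p.2 : ℕ) - 1, by omega⟩), PiLp.ext fun p => ?_⟩
  rw [z_apply]
  split_ifs with hp
  · rfl
  · exact (mem_ker_z_pow.1 hv p (by omega)).symm

lemma En_eq_ker_z_pow (N n : ℕ) : En N n = LinearMap.ker (z N ^ n) := by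
  apply le_antisymm
  · refine Submodule.span_le.2 ?_
    rintro _ ⟨k, j, hj, rfl⟩
    refine mem_ker_z_pow.2 fun p hp => ?_
    rw [PiLp.single_apply, if_neg]
    rintro rfl
    exact hp.not_gt hj
  · intro v hv
    rw [← (EuclideanSpace.basisFun (Fin 2 × Fin N) ℂ).sum_repr v]
    refine Submodule.sum_mem _ fun p _ => ?_
    rcases lt_or_ge (p.2 : ℕ) n with hp | hp
    · exact Submodule.smul_mem _ _
        (Submodule.subset_span ⟨p.1, p.2, hp, EuclideanSpace.basisFun_apply _ ℂ p⟩)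
    · simp [mem_ker_z_pow.1 hv p hp]

end Shift

section PowComap

variable {R M : Type*} [Semiring R] [AddCommMonoid M] [Module R M] (f : Module.End R M)
  (L : Submodule R M)

lemma comap_pow_zero : L.comap (f ^ 0) = L := by
  rw [pow_zero, Module.End.one_eq_id, Submodule.comap_id]

lemma comap_pow_add (k l : ℕ) : L.comap (f ^ (k + l)) = (L.comap (f ^ k)).comap (f ^ l) := by
  rw [pow_add, Module.End.mul_eq_comp, Submodule.comap_comp]

lemma comap_pow_succ (k : ℕ) : L.comap (f ^ (k + 1)) = (L.comap (f ^ k)).comap f := by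
  rw [comap_pow_add, pow_one]

lemma comap_pow_succ' (k : ℕ) : L.comap (f ^ (k + 1)) = (L.comap f).comap (f ^ k) := by
  rw [add_comm, comap_pow_add, pow_one]

end PowComap

lemma comap_z_le_ker_pow {N a : ℕ} {L : Submodule ℂ (E N)} (h : L ≤ LinearMap.ker (z N ^ a)) :
    L.comap (z N) ≤ LinearMap.ker (z N ^ (a + 1)) := by
  rw [← Submodule.comap_bot, comap_pow_succ, Submodule.comap_bot]
  exact Submodule.comap_mono h

lemma finrank_comap_z_pow {N a : ℕ} {L : Submodule ℂ (E N)} (h : L ≤ LinearMap.ker (z N ^ a))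
    (k : ℕ) (hk : a + k ≤ N) :
    Module.finrank ℂ (L.comap (z N ^ k)) = Module.finrank ℂ L + 2 * k := by
  induction k generalizing L a with
  | zero => rw [comap_pow_zero, mul_zero, add_zero]
  | succ k ih =>
    rw [comap_pow_succ', ih (comap_z_le_ker_pow h) (by omega),
      finrank_comap_z (by omega) (h.trans (ker_z_pow_le_range (by omega)))]
    ring

section Layer

variable {N a : ℕ} {L L' : Submodule ℂ (E N)} {l : Submodule ℂ C2}

/-- The subspace `C(L' ∩ L^⊥)` of `ℂ²`. For `L = L_{j-1}` and `L' = L_j` it is the `j`-th line of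
`phi`. -/
def layer (L L' : Submodule ℂ (E N)) : Submodule ℂ C2 := (L' ⊓ Lᗮ).map (C N)

/-- The subspace between `L` and `z⁻¹ L` whose layer over `L` is `l`; see `layer_addLayer` and
`addLayer_layer`. -/
def addLayer (L : Submodule ℂ (E N)) (l : Submodule ℂ C2) : Submodule ℂ (E N) :=
  L ⊔ L.comap (z N) ⊓ Lᗮ ⊓ l.comap (C N)

lemma le_addLayer : L ≤ addLayer L l := le_sup_left

lemma addLayer_le_comap_z (hL : L ≤ L.comap (z N)) : addLayer L l ≤ L.comap (z N) :=
  sup_le hL (inf_le_left.trans inf_le_left)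

lemma layer_addLayer (hN : 0 < N) (hL : L ≤ L.comap (z N)) (hr : L ≤ LinearMap.range (z N)) :
    layer L (addLayer L l) = l := by
  have hle : L.comap (z N) ⊓ Lᗮ ⊓ l.comap (C N) ≤ Lᗮ := inf_le_left.trans inf_le_right
  rw [layer, addLayer, sup_comm, sup_inf_assoc_of_le _ hle, L.inf_orthogonal_eq_bot, sup_bot_eq,
    ← Submodule.map_inf_eq_map_inf_comap, map_C_comap_z_inf_orthogonal hN hL hr, top_inf_eq]

lemma addLayer_layer (hL : L ≤ L.comap (z N)) (h : L ≤ L') (h' : L' ≤ L.comap (z N)) :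
    addLayer L (layer L L') = L' := by
  rw [addLayer, layer, (isIsometricOn_C hL).inf_comap_map (inf_le_inf_right _ h'), inf_comm,
    Submodule.sup_orthogonal_inf_of_hasOrthogonalProjection h]

lemma finrank_add_finrank_layer (hL : L ≤ L.comap (z N)) (h : L ≤ L')
    (h' : L' ≤ L.comap (z N)) :
    Module.finrank ℂ L + Module.finrank ℂ (layer L L') = Module.finrank ℂ L' := by
  rw [layer, ((isIsometricOn_C hL).mono (inf_le_inf_right _ h')).finrank_map, inf_comm,
    Submodule.finrank_add_inf_finrank_orthogonal h]

lemma layer_comap_z_right (hN : 0 < N) (hL : L ≤ L.comap (z N))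
    (hr : L ≤ LinearMap.range (z N)) (h : L ≤ L') (h' : L' ≤ L.comap (z N)) :
    layer L' (L.comap (z N)) = (layer L L')ᗮ := by
  have horth : L'ᗮ = Lᗮ ⊓ (L' ⊓ Lᗮ)ᗮ := by
    rw [Submodule.inf_orthogonal, inf_comm L',
      Submodule.sup_orthogonal_inf_of_hasOrthogonalProjection h]
  rw [layer, layer, horth, ← inf_assoc,
    (isIsometricOn_C hL).map_inf_orthogonal (inf_le_inf_right _ h'),
    map_C_comap_z_inf_orthogonal hN hL hr, top_inf_eq]

lemma layer_comap_z (hr : L ≤ LinearMap.range (z N)) (hr' : L' ≤ LinearMap.range (z N)) :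
    layer (L.comap (z N)) (L'.comap (z N)) = layer L L' := by
  rw [layer, layer, ← map_comap_inf_orthogonal isIsometricOn_z_ker_orthogonal hr hr',
    ← Submodule.map_comp]
  ext w
  refine exists_congr fun v => and_congr_right fun hv => ?_
  have hker : v ∈ (LinearMap.ker (z N))ᗮ :=
    Submodule.orthogonal_le (Submodule.comap_mono bot_le) hv.2
  rw [LinearMap.comp_apply, C_z_of_mem_ker_orthogonal hker]

lemma layer_comap_z_pow (h : L ≤ LinearMap.ker (z N ^ a)) (h' : L' ≤ LinearMap.ker (z N ^ a))
    (k : ℕ) (hk : a + k ≤ N) :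
    layer (L.comap (z N ^ k)) (L'.comap (z N ^ k)) = layer L L' := by
  induction k generalizing L L' a with
  | zero => rw [comap_pow_zero, comap_pow_zero]
  | succ k ih =>
    have hr : LinearMap.ker (z N ^ a) ≤ LinearMap.range (z N) := ker_z_pow_le_range (by omega)
    rw [comap_pow_succ', comap_pow_succ', ih (comap_z_le_ker_pow h) (comap_z_le_ker_pow h')
      (by omega), layer_comap_z (h.trans hr) (h'.trans hr)]

lemma starProjection_layer (hL : L ≤ L.comap (z N)) (h : L ≤ L') (h' : L' ≤ L.comap (z N)) :
    (layer L L').starProjection = (C N).toContinuousLinearMap ∘L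
      (L'.starProjection - L.starProjection) ∘L (C N).adjoint.toContinuousLinearMap := by
  ext1 w
  rw [starProjection_sub_starProjection h]
  exact ((isIsometricOn_C hL).mono (inf_le_inf_right _ h')).starProjection_map w

lemma starProjection_eq_add_layer (hL : L ≤ L.comap (z N)) (h : L ≤ L')
    (h' : L' ≤ L.comap (z N)) :
    L'.starProjection = L.starProjection +
      (L.comap (z N) ⊓ Lᗮ).starProjection ∘L (C N).adjoint.toContinuousLinearMap ∘L
        (layer L L').starProjection ∘L (C N).toContinuousLinearMap ∘L
          (L.comap (z N) ⊓ Lᗮ).starProjection := by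
  rw [← sub_eq_iff_eq_add', starProjection_sub_starProjection h]
  ext1 v
  exact (isIsometricOn_C hL).starProjection_eq_of_le (inf_le_inf_right _ h') v

lemma starProjection_comap_z_inf_orthogonal (hL : L ≤ L.comap (z N))
    (hr : L ≤ LinearMap.range (z N)) (v : E N) :
    (L.comap (z N) ⊓ Lᗮ).starProjection v =
      v - (z N).adjoint (z N v) + (z N).adjoint (L.starProjection (z N v)) -
        L.starProjection v := by
  rw [← starProjection_sub_starProjection hL, sub_apply,
    starProjection_comap isIsometricOn_z_ker_orthogonal hr]

end Layer

section Perp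

lemma submodule_perp (l : P1) : (perp l).submodule = l.submoduleᗮ :=
  Projectivization.submodule_mk'' _ _

lemma perp_perp (l : P1) : perp (perp l) = l :=
  Projectivization.submodule_injective <| by
    rw [submodule_perp, submodule_perp, Submodule.orthogonal_orthogonal]

variable {m : ℕ} (l : Fin m → P1)

lemma I_I : I m (I m l) = l := by
  ext1 j
  unfold I
  split_ifs
  exacts [perp_perp _, rfl]

lemma I_apply_eq_I_apply_iff {l : Fin m → P1} {i j : Fin m} (h : Odd ((i : ℕ) + j)) :
    I m l i = I m l j ↔ l j = perp (l i) := by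
  unfold I
  by_cases hi : Even ((i : ℕ) + 1)
  · rw [if_pos hi, if_neg (by grind), eq_comm]
  · rw [if_neg hi, if_pos (by grind)]
    exact ⟨fun h => by rw [h, perp_perp], fun h => by rw [h, perp_perp]⟩

end Perp

section Flag

variable {N : ℕ} (y : ℕ → P1)

/-- The flag `0 = L_0 ⊂ L_1 ⊂ …` whose layer between `L_k` and `L_{k+1}` is the line `y k`. It is
a complete flag as long as `k ≤ N`. -/
def flag (N : ℕ) (y : ℕ → P1) : ℕ → Submodule ℂ (E N)
  | 0 => ⊥
  | k + 1 => addLayer (flag N y k) (y k).submodule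

lemma flag_succ (k : ℕ) : flag N y (k + 1) = addLayer (flag N y k) (y k).submodule := rfl

lemma flag_le_succ (k : ℕ) : flag N y k ≤ flag N y (k + 1) := le_addLayer

lemma flag_mono : Monotone (flag N y) := monotone_nat_of_le_succ (flag_le_succ y)

lemma flag_le_comap_z (k : ℕ) : flag N y k ≤ (flag N y k).comap (z N) := by
  induction k with
  | zero => exact bot_le
  | succ k ih => exact (addLayer_le_comap_z ih).trans (Submodule.comap_mono (flag_le_succ y k))

lemma flag_succ_le_comap_z (k : ℕ) : flag N y (k + 1) ≤ (flag N y k).comap (z N) :=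
  addLayer_le_comap_z (flag_le_comap_z y k)

lemma flag_le_ker_z_pow (k : ℕ) : flag N y k ≤ LinearMap.ker (z N ^ k) := by
  induction k with
  | zero => exact bot_le
  | succ k ih => exact (flag_succ_le_comap_z y k).trans (comap_z_le_ker_pow ih)

variable {y} {k : ℕ}

lemma flag_le_range_z (hk : k < N) : flag N y k ≤ LinearMap.range (z N) :=
  (flag_le_ker_z_pow y k).trans (ker_z_pow_le_range hk)

lemma layer_flag (hk : k < N) : layer (flag N y k) (flag N y (k + 1)) = (y k).submodule :=
  layer_addLayer (k.zero_le.trans_lt hk) (flag_le_comap_z y k) (flag_le_range_z hk)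

lemma eq_flag_succ {L : Submodule ℂ (E N)} (h : flag N y k ≤ L)
    (h' : L ≤ (flag N y k).comap (z N)) (hy : layer (flag N y k) L = (y k).submodule) :
    L = flag N y (k + 1) := by
  rw [flag_succ, ← hy, addLayer_layer (flag_le_comap_z y k) h h']

lemma finrank_flag (hk : k ≤ N) : Module.finrank ℂ (flag N y k) = k := by
  induction k with
  | zero => exact finrank_bot ℂ (E N)
  | succ k ih =>
    rw [← finrank_add_finrank_layer (flag_le_comap_z y k) (flag_le_succ y k)
      (flag_succ_le_comap_z y k), ih (Nat.le_of_succ_le hk), layer_flag hk,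
      Projectivization.finrank_submodule]

lemma flag_congr {y' : ℕ → P1} (h : ∀ i < k, y i = y' i) : flag N y k = flag N y' k := by
  induction k with
  | zero => rfl
  | succ k ih =>
    rw [flag_succ, flag_succ, ih fun i hi => h i (hi.trans k.lt_succ_self), h k k.lt_succ_self]

end Flag

section OfLines

variable {N m : ℕ}

/-- The sequence starting with the tuple `l` and continuing with an arbitrary constant. -/
def extend (l : Fin m → P1) : ℕ → P1 :=
  Function.extend Fin.val l fun _ => Classical.arbitrary P1

lemma extend_val (l : Fin m → P1) (j : Fin m) : extend l j = l j :=
  Fin.val_injective.extend_apply _ _ j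

/-- The first `m` steps of the flag with layers `l`, as a point of `Y_m`. -/
def ofLines (hm : m ≤ N) (l : Fin m → P1) : Y N m where
  L j := flag N (extend l) j
  strictMono i j hij := by
    refine (flag_mono _ hij.le).lt_of_ne fun h => hij.ne (Fin.ext ?_)
    rw [← finrank_flag (N := N) (y := extend l) (i.is_le.trans hm), h,
      finrank_flag (j.is_le.trans hm)]
  finrank_eq j := finrank_flag (j.is_le.trans hm)
  stable j := Submodule.map_le_iff_le_comap.2 (flag_le_comap_z _ j)

lemma submodule_phi (F : Y N m) (j : Fin m) :
    (phi N m F j).submodule = layer (F.L j.castSucc) (F.L j.succ) :=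
  Projectivization.submodule_mk'' _ _

lemma phi_ofLines (hm : m ≤ N) (l : Fin m → P1) : phi N m (ofLines hm l) = l := by
  ext1 j
  apply Projectivization.submodule_injective
  rw [submodule_phi, ← extend_val l j]
  exact layer_flag (j.2.trans_le hm)

lemma Y.castSucc_le_succ (F : Y N m) (j : Fin m) : F.L j.castSucc ≤ F.L j.succ :=
  F.strictMono.monotone j.castSucc_le_succ

lemma Y.succ_le_comap_z (F : Y N m) (j : Fin m) : F.L j.succ ≤ (F.L j.castSucc).comap (z N) :=
  fun _ hv => F.z_mem j hv

lemma Y.L_eq_flag (F : Y N m) (j : Fin (m + 1)) : F.L j = flag N (extend (phi N m F)) j := by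
  induction j using Fin.induction with
  | zero => exact Submodule.finrank_eq_zero.1 (F.finrank_eq 0)
  | succ j ih =>
    rw [Fin.val_castSucc] at ih
    refine eq_flag_succ (ih ▸ F.castSucc_le_succ j) (ih ▸ F.succ_le_comap_z j) ?_
    rw [← ih, extend_val, submodule_phi]

lemma ofLines_phi (hm : m ≤ N) (F : Y N m) : ofLines hm (phi N m F) = F := by
  ext1
  ext1 j
  exact (F.L_eq_flag j).symm

end OfLines

section Smooth

variable {N m : ℕ}

lemma IsSmooth.of_contDiff {A B V W : Type*} [NormedAddCommGroup V] [NormedSpace ℝ V]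
    [NormedSpace ℂ V] [IsScalarTower ℝ ℂ V] [NormedAddCommGroup W] [NormedSpace ℝ W]
    [NormedSpace ℂ W] [IsScalarTower ℝ ℂ W] {ι : A → V} {κ : B → W} {f : A → B} {G : V → W}
    (hG : ContDiff ℂ ∞ G) (h : ∀ a, G (ι a) = κ (f a)) : IsSmooth ι κ f := fun _ =>
  ⟨Set.univ, G, isOpen_univ, Set.mem_univ _, (hG.restrict_scalars ℝ).contDiffOn, fun a _ => h a⟩

/-- The effect of `I` on tuples of orthogonal projections. -/
def projI (m : ℕ) (Q : Fin m → (C2 →L[ℂ] C2)) : Fin m → (C2 →L[ℂ] C2) := fun j =>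
  if Even ((j : ℕ) + 1) then 1 - Q j else Q j

lemma projI_lineProj (l : Fin m → P1) : projI m (lineProj m l) = lineProj m (I m l) := by
  ext1 j
  unfold projI lineProj I
  split_ifs
  · rw [← Submodule.starProjection_orthogonal', Submodule.starProjection_inj, submodule_perp]
  · rfl

lemma contDiff_projI : ContDiff ℂ ∞ (projI m) := by
  refine contDiff_pi.2 fun j => ?_
  unfold projI
  split_ifs
  · exact contDiff_const.sub (contDiff_apply ℂ _ j)
  · exact contDiff_apply ℂ _ j

lemma isSmooth_I_phi : IsSmooth (flagProj N m) (lineProj m) (I m ∘ phi N m) := by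
  let G : (Fin (m + 1) → (E N →L[ℂ] E N)) → Fin m → (C2 →L[ℂ] C2) := fun P j =>
    (C N).toContinuousLinearMap ∘L (P j.succ - P j.castSucc) ∘L
      (C N).adjoint.toContinuousLinearMap
  have hG : ContDiff ℂ ∞ G := contDiff_pi.2 fun j => contDiff_const.clm_comp
    (((contDiff_apply ℂ _ j.succ).sub (contDiff_apply ℂ _ j.castSucc)).clm_comp contDiff_const)
  refine IsSmooth.of_contDiff (contDiff_projI.comp hG) fun F => ?_
  have hphi : G (flagProj N m F) = lineProj m (phi N m F) := by
    ext1 j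
    refine (starProjection_layer (Submodule.map_le_iff_le_comap.1 (F.stable _))
      (F.castSucc_le_succ j) (F.succ_le_comap_z j)).symm.trans ?_
    exact Submodule.starProjection_inj.2 (submodule_phi F j).symm
  rw [Function.comp_apply, hphi, projI_lineProj, Function.comp_apply]

/-- The polynomial map that sends the orthogonal projection onto `L` to the one onto
`z⁻¹ L ∩ L^⊥`. -/
def gapProj (N : ℕ) (P : E N →L[ℂ] E N) : E N →L[ℂ] E N :=
  1 - (z N).adjoint.toContinuousLinearMap ∘L (z N).toContinuousLinearMap +
    (z N).adjoint.toContinuousLinearMap ∘L P ∘L (z N).toContinuousLinearMap - P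

lemma gapProj_starProjection {L : Submodule ℂ (E N)} (hL : L ≤ L.comap (z N))
    (hr : L ≤ LinearMap.range (z N)) :
    gapProj N L.starProjection = (L.comap (z N) ⊓ Lᗮ).starProjection := by
  ext1 v
  exact (starProjection_comap_z_inf_orthogonal hL hr v).symm

lemma contDiff_gapProj : ContDiff ℂ ∞ (gapProj N) :=
  (contDiff_const.add (contDiff_const.clm_comp (contDiff_id.clm_comp contDiff_const))).sub
    contDiff_id

lemma exists_contDiff_starProjection_flag (hm : m ≤ N) {k : ℕ} (hk : k ≤ m) :
    ∃ G : (Fin m → (C2 →L[ℂ] C2)) → (E N →L[ℂ] E N), ContDiff ℂ ∞ G ∧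
      ∀ l, G (lineProj m l) = (flag N (extend l) k).starProjection := by
  induction k with
  | zero => exact ⟨fun _ => 0, contDiff_const, fun _ => Submodule.starProjection_bot.symm⟩
  | succ k ih =>
    obtain ⟨G, hG, hflag⟩ := ih (Nat.le_of_succ_le hk)
    have hgap := contDiff_gapProj.comp hG
    refine ⟨fun Q => G Q + gapProj N (G Q) ∘L (C N).adjoint.toContinuousLinearMap ∘L
      Q ⟨k, hk⟩ ∘L (C N).toContinuousLinearMap ∘L gapProj N (G Q), ?_, fun l => ?_⟩
    · exact hG.add (hgap.clm_comp (contDiff_const.clm_comp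
        ((contDiff_apply ℂ _ _).clm_comp (contDiff_const.clm_comp hgap))))
    · have hkN : k < N := Nat.lt_of_succ_le (hk.trans hm)
      have hline : lineProj m l ⟨k, hk⟩ =
          (layer (flag N (extend l) k) (flag N (extend l) (k + 1))).starProjection :=
        Submodule.starProjection_inj.2 (by rw [layer_flag hkN, extend_val l ⟨k, hk⟩])
      beta_reduce
      rw [hflag, gapProj_starProjection (flag_le_comap_z _ k) (flag_le_range_z hkN), hline,
        ← starProjection_eq_add_layer (flag_le_comap_z _ k) (flag_le_succ _ k)
          (flag_succ_le_comap_z _ k)]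

lemma isSmooth_ofLines_I (hm : m ≤ N) :
    IsSmooth (lineProj m) (flagProj N m) (ofLines hm ∘ I m) := by
  choose G hG hflag using fun j : Fin (m + 1) => exists_contDiff_starProjection_flag hm j.is_le
  refine IsSmooth.of_contDiff ((contDiff_pi.2 hG).comp contDiff_projI) fun l => ?_
  ext1 j
  rw [Function.comp_apply, projI_lineProj]
  exact hflag j (I m l)

lemma IsDiffeo.surjective {A B V W : Type*} [NormedAddCommGroup V] [NormedSpace ℝ V]
    [NormedAddCommGroup W] [NormedSpace ℝ W] {ι : A → V} {κ : B → W} {f : A → B}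
    (h : IsDiffeo ι κ f) : Function.Surjective f :=
  let ⟨_, _, _, hright, _⟩ := h
  hright.surjective

lemma isDiffeo_I_phi (hm : m ≤ N) : IsDiffeo (flagProj N m) (lineProj m) (I m ∘ phi N m) :=
  ⟨isSmooth_I_phi, ofLines hm ∘ I m,
    fun F => by simp only [Function.comp_apply, I_I, ofLines_phi],
    fun l => by simp only [Function.comp_apply, phi_ofLines, I_I], isSmooth_ofLines_I hm⟩

end Smooth

section Matching

variable {n : ℕ} (a : Matching n)

/-- No pair of `a` joins a point of the interval `p, …, q - 1` to a point outside of it. -/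
def Matching.ClosedOn (p q : ℕ) : Prop :=
  ∀ i : Fin (2 * n), p ≤ i → (i : ℕ) < q → p ≤ a.s i ∧ (a.s i : ℕ) < q

lemma Matching.closedOn_univ : a.ClosedOn 0 (2 * n) := fun i _ _ => ⟨Nat.zero_le _, (a.s i).2⟩

lemma Matching.closedOn_inside (i : Fin (2 * n)) : a.ClosedOn (i + 1) (a.s i) := by
  intro j (hij : i < j) (hjt : j < a.s i)
  have hne_left : a.s j ≠ i := fun h => hjt.ne (by rw [← h, a.involutive])
  have hne_right : a.s j ≠ a.s i := fun h => hij.ne' (a.involutive.injective h)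
  have hle : i ≤ a.s j := not_lt.1 fun h =>
    a.crossingless ⟨a.s j, i, j, a.s i, h, hij, hjt, a.involutive j, rfl⟩
  have hge : a.s j ≤ a.s i := not_lt.1 fun h =>
    a.crossingless ⟨i, j, a.s i, a.s j, hij, hjt, h, rfl, rfl⟩
  exact ⟨hle.lt_of_ne hne_left.symm, hge.lt_of_ne hne_right⟩

variable {a}

lemma Matching.ClosedOn.after {i : Fin (2 * n)} {q : ℕ} (hi : i ∈ a.O) (h : a.ClosedOn i q) :
    a.ClosedOn (a.s i + 1) q := by
  intro j (htj : a.s i < j) hjq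
  have hit : i < a.s i := hi
  obtain ⟨hij, hlt⟩ := h j (hit.trans htj).le hjq
  refine ⟨Nat.succ_le_of_lt (lt_of_not_ge fun hle => ?_), hlt⟩
  have hne_left : i ≠ a.s j := fun h => htj.ne (by rw [h, a.involutive])
  have hne_right : a.s j ≠ a.s i := fun h => (hit.trans htj).ne' (a.involutive.injective h)
  have hinside := a.closedOn_inside i (a.s j) (lt_of_le_of_ne hij (Fin.val_ne_of_ne hne_left))
    (lt_of_le_of_ne hle (Fin.val_ne_of_ne hne_right))
  rw [a.involutive] at hinside
  exact hinside.2.not_gt htj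

/-- A closed interval is empty, or it starts with an arc followed by a closed interval. -/
lemma Matching.ClosedOn.induction {P : ℕ → ℕ → Prop} (refl : ∀ p, P p p)
    (arc : ∀ i ∈ a.O, P (i + 1) (a.s i) → P i (a.s i + 1))
    (trans : ∀ p q r, P p q → P q r → P p r) {p q : ℕ} (hpq : p ≤ q) (hq : q ≤ 2 * n)
    (h : a.ClosedOn p q) : P p q := by
  induction hd : q - p using Nat.strong_induction_on generalizing p q with
  | _ d ih =>
    obtain rfl | hlt := hpq.eq_or_lt
    · exact refl p
    lift p to Fin (2 * n) using hlt.trans_le hq with i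
    obtain ⟨hle, hlt'⟩ := h i le_rfl hlt
    have hi : i ∈ a.O := (Fin.le_def.2 hle).lt_of_ne (a.ne_self i).symm
    have hit : (i : ℕ) < a.s i := hi
    exact trans i (a.s i + 1) q
      (arc i hi (ih _ (by omega) hit (a.s i).2.le (a.closedOn_inside i) rfl))
      (ih _ (by omega) hlt' hq (h.after hi) rfl)

lemma Matching.odd_add_s {i : Fin (2 * n)} (hi : i ∈ a.O) : Odd ((i : ℕ) + a.s i) := by
  have heven : Even ((i : ℕ) + 1 + a.s i) :=
    (a.closedOn_inside i).induction (P := fun p q => Even (p + q)) (fun p => ⟨p, rfl⟩)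
      (by grind) (by grind) hi (a.s i).2.le
  grind

lemma Matching.s_add_one {i : Fin (2 * n)} (hi : i ∈ a.O) :
    (a.s i : ℕ) + 1 = i + 2 * a.d i := by
  have hit : (i : ℕ) < a.s i := hi
  have := a.odd_add_s hi
  unfold d
  grind

end Matching

section IsShift

variable {N : ℕ} {y : ℕ → P1} {p q r : ℕ}

/-- The `q`-th step of the flag is the preimage of the `p`-th one under a power of `z`. The
exponent is half of `q - p`, since each application of `z⁻¹` raises the dimension by `2`. -/
def IsShift (N : ℕ) (y : ℕ → P1) (p q : ℕ) : Prop :=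
  ∃ k, q = p + 2 * k ∧ flag N y q = (flag N y p).comap (z N ^ k)

lemma IsShift.refl (p : ℕ) : IsShift N y p p := ⟨0, rfl, (comap_pow_zero _ _).symm⟩

lemma IsShift.trans (h : IsShift N y p q) (h' : IsShift N y q r) : IsShift N y p r := by
  obtain ⟨k, rfl, hk⟩ := h
  obtain ⟨l, rfl, hl⟩ := h'
  exact ⟨k + l, by ring, by rw [hl, hk, comap_pow_add]⟩

lemma isShift_iff {k : ℕ} (h : q = p + 2 * k) :
    IsShift N y p q ↔ flag N y q = (flag N y p).comap (z N ^ k) := by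
  refine ⟨?_, fun hflag => ⟨k, h, hflag⟩⟩
  rintro ⟨l, hl, hflag⟩
  obtain rfl : k = l := by omega
  exact hflag

lemma isShift_zero_iff {n : ℕ} :
    IsShift N y 0 (2 * n) ↔ flag N y (2 * n) = LinearMap.ker (z N ^ n) :=
  isShift_iff (zero_add _).symm

lemma isShift_add_two_iff :
    IsShift N y p (p + 2) ↔ flag N y (p + 2) = (flag N y p).comap (z N) := by
  rw [isShift_iff (k := 1) rfl, pow_one]

lemma layer_comap_z_pow_flag {k : ℕ} (hk : p + 1 + k ≤ N) :
    layer ((flag N y (p + 1)).comap (z N ^ k)) ((flag N y p).comap (z N ^ (k + 1))) =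
      (perp (y p)).submodule := by
  have hp : p < N := by omega
  rw [comap_pow_succ', layer_comap_z_pow (flag_le_ker_z_pow y (p + 1))
    (comap_z_le_ker_pow (flag_le_ker_z_pow y p)) k hk,
    layer_comap_z_right (by omega) (flag_le_comap_z y p) (flag_le_range_z hp) (flag_le_succ y p)
      (flag_succ_le_comap_z y p), layer_flag hp, submodule_perp]

lemma isShift_arc_iff (h : IsShift N y (p + 1) q) (hq : q < N) :
    IsShift N y p (q + 1) ↔ y q = perp (y p) := by
  obtain ⟨k, hqk, hflag⟩ := h
  have hlayer : layer (flag N y q) ((flag N y p).comap (z N ^ (k + 1))) =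
      (perp (y p)).submodule := hflag ▸ layer_comap_z_pow_flag (by omega)
  constructor
  · rintro ⟨l, hl, hflag'⟩
    obtain rfl : l = k + 1 := by omega
    apply Projectivization.submodule_injective
    rw [← layer_flag hq, hflag', hlayer]
  · intro hy
    refine ⟨k + 1, by omega, (eq_flag_succ ?_ ?_ (by rw [hlayer, hy])).symm⟩
    · rw [hflag, comap_pow_succ']
      exact Submodule.comap_mono (flag_succ_le_comap_z y p)
    · rw [hflag, comap_pow_succ]
      exact Submodule.comap_mono (Submodule.comap_mono (flag_le_succ y p))

variable {n : ℕ} {a : Matching n}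

lemma Matching.ClosedOn.isShift
    (harc : ∀ i ∈ a.O, IsShift N y (i + 1) (a.s i) → IsShift N y i (a.s i + 1)) (hpq : p ≤ q)
    (hq : q ≤ 2 * n) (h : a.ClosedOn p q) : IsShift N y p q :=
  h.induction IsShift.refl harc (fun _ _ _ => IsShift.trans) hpq hq

lemma forall_isShift_iff (hN : 2 * n ≤ N) :
    (∀ i ∈ a.O, IsShift N y i (a.s i + 1)) ↔ ∀ i ∈ a.O, y (a.s i) = perp (y i) := by
  have hiff {i : Fin (2 * n)} (h : IsShift N y (i + 1) (a.s i)) :=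
    isShift_arc_iff h ((a.s i).2.trans_le hN)
  constructor
  · intro hshift i hi
    exact (hiff ((a.closedOn_inside i).isShift (fun j hj _ => hshift j hj) hi (a.s i).2.le)).1
      (hshift i hi)
  · intro hperp i hi
    have harc (j) (hj : j ∈ a.O) (h : IsShift N y (j + 1) (a.s j)) := (hiff h).2 (hperp j hj)
    exact harc i hi ((a.closedOn_inside i).isShift harc hi (a.s i).2.le)

end IsShift

section RemovePair

variable {N : ℕ} {y : ℕ → P1}

lemma exists_isShift_add_two {m : ℕ} (hN : 0 < N) (hm : m ≤ N)
    (hker : LinearMap.ker (z N) ≤ flag N y m) : ∃ j, j + 2 ≤ m ∧ IsShift N y j (j + 2) := by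
  classical
  have hex : ∃ q, LinearMap.ker (z N) ≤ flag N y q := ⟨m, hker⟩
  obtain ⟨q, hq, hmin⟩ : ∃ q, LinearMap.ker (z N) ≤ flag N y q ∧
      ∀ r < q, ¬ LinearMap.ker (z N) ≤ flag N y r :=
    ⟨Nat.find hex, Nat.find_spec hex, fun _ => Nat.find_min hex⟩
  have hqm : q ≤ m := not_lt.1 fun h => hmin m h hker
  have htwo : 2 ≤ q := by
    have := Submodule.finrank_mono hq
    rwa [finrank_ker_z hN, finrank_flag (hqm.trans hm)] at this
  obtain ⟨j, rfl⟩ := Nat.exists_eq_add_of_le' htwo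
  have hlt : flag N y (j + 1) < flag N y (j + 1) ⊔ LinearMap.ker (z N) :=
    left_lt_sup.2 (hmin (j + 1) (Nat.lt_succ_self _))
  have hsup : flag N y (j + 1) ⊔ LinearMap.ker (z N) = flag N y (j + 2) := by
    refine Submodule.eq_of_le_of_finrank_le (sup_le (flag_le_succ y _) hq) ?_
    have := Submodule.finrank_lt_finrank_of_lt hlt
    rw [finrank_flag (by omega)] at this ⊢
    exact this
  have hle : flag N y (j + 2) ≤ (flag N y j).comap (z N) :=
    hsup ▸ sup_le (flag_succ_le_comap_z y j) (LinearMap.ker_le_comap _)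
  refine ⟨j, hqm, isShift_add_two_iff.2 (Submodule.eq_of_le_of_finrank_eq hle ?_)⟩
  rw [finrank_comap_z hN (flag_le_range_z (by omega)), finrank_flag (by omega),
    finrank_flag (by omega)]

/-- The sequence `y` without its terms with indices `j` and `j + 1`. -/
def removePair (j : ℕ) (y : ℕ → P1) (k : ℕ) : P1 := if k < j then y k else y (k + 2)

lemma flag_eq_comap_flag_removePair {i j : ℕ} (hj : IsShift N y j (j + 2)) (hji : j ≤ i)
    (hi : i + 2 ≤ N) : flag N y (i + 2) = (flag N (removePair j y) i).comap (z N) := by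
  induction i, hji using Nat.le_induction with
  | base =>
    rw [isShift_add_two_iff.1 hj, flag_congr fun k hk => (if_pos hk).symm]
    rfl
  | succ i hji ih =>
    have hflag := ih (by omega)
    refine (eq_flag_succ ?_ ?_ ?_).symm
    · rw [hflag]
      exact Submodule.comap_mono (flag_le_succ _ i)
    · rw [hflag]
      exact Submodule.comap_mono (flag_succ_le_comap_z _ i)
    · rw [hflag, layer_comap_z (flag_le_range_z (by omega)) (flag_le_range_z (by omega)),
        layer_flag (by omega), removePair, if_neg hji.not_gt]

lemma flag_removePair_eq_ker {n j : ℕ} (hj : IsShift N y j (j + 2)) (hjn : j ≤ 2 * n)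
    (hN : 2 * n + 2 ≤ N) (h : flag N y (2 * n + 2) = LinearMap.ker (z N ^ (n + 1))) :
    flag N (removePair j y) (2 * n) = LinearMap.ker (z N ^ n) := by
  have hcomap : (flag N (removePair j y) (2 * n)).comap (z N) =
      (LinearMap.ker (z N ^ n)).comap (z N) := by
    rw [← flag_eq_comap_flag_removePair hj hjn hN, h, LinearMap.ker, comap_pow_succ]
    rfl
  have hmap := congrArg (Submodule.map (z N)) hcomap
  rwa [Submodule.map_comap_eq_of_le (flag_le_range_z (by omega)),
    Submodule.map_comap_eq_of_le (ker_z_pow_le_range (by omega))] at hmap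

end RemovePair

section InsertPair

variable {m n : ℕ} (j : Fin (m + 1)) (s : Fin m → Fin m)

/-- The order embedding of `Fin m` into `Fin (m + 2)` that omits `j` and `j + 1`. -/
def skip (i : Fin m) : Fin (m + 2) := j.castSucc.succAbove (j.succAbove i)

/-- The map `s`, transported along `skip j` and extended by exchanging `j` and `j + 1`. -/
def insertPair : Fin (m + 2) → Fin (m + 2) :=
  j.castSucc.insertNth j.succ (j.insertNth j.castSucc fun i => skip j (s i))

lemma strictMono_skip : StrictMono (skip j) :=
  (Fin.strictMono_succAbove _).comp (Fin.strictMono_succAbove _)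

lemma val_skip (i : Fin m) : (skip j i : ℕ) = if (i : ℕ) < j then (i : ℕ) else i + 2 := by
  unfold skip Fin.succAbove
  grind

lemma removePair_apply (y : ℕ → P1) (i : Fin m) : removePair j y i = y (skip j i) := by
  rw [removePair, val_skip, apply_ite y]

variable {j} in
lemma forall_iff_skip {P : Fin (m + 2) → Prop} :
    (∀ i, P i) ↔ P j.castSucc ∧ P j.succ ∧ ∀ i, P (skip j i) := by
  rw [Fin.forall_iff_succAbove j.castSucc, Fin.forall_iff_succAbove j,
    Fin.succAbove_castSucc_self]
  rfl

lemma insertPair_castSucc : insertPair j s j.castSucc = j.succ := Fin.insertNth_apply_same _ _ _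

lemma insertPair_succ : insertPair j s j.succ = j.castSucc := by
  rw [insertPair, ← Fin.succAbove_castSucc_self j, Fin.insertNth_apply_succAbove,
    Fin.insertNth_apply_same]

lemma insertPair_skip (i : Fin m) : insertPair j s (skip j i) = skip j (s i) := by
  rw [insertPair, skip, Fin.insertNth_apply_succAbove, Fin.insertNth_apply_succAbove]

/-- The matching `a` with an arc between the adjacent points `j` and `j + 1` inserted. -/
def Matching.insertPair (a : Matching n) (j : Fin (2 * n + 1)) : Matching (n + 1) where
  s := Springer.insertPair j a.s
  involutive := by
    refine forall_iff_skip (j := j).2 ⟨?_, ?_, fun i => ?_⟩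
    · rw [insertPair_castSucc, insertPair_succ]
    · rw [insertPair_succ, insertPair_castSucc]
    · rw [insertPair_skip, insertPair_skip, a.involutive]
  ne_self := by
    refine forall_iff_skip (j := j).2 ⟨?_, ?_, fun i => ?_⟩
    · rw [insertPair_castSucc]
      exact j.castSucc_lt_succ.ne'
    · rw [insertPair_succ]
      exact j.castSucc_lt_succ.ne
    · rw [insertPair_skip]
      exact (strictMono_skip j).injective.ne (a.ne_self i)
  crossingless := by
    rintro ⟨i, k, _, _, hik, hki, hlt, rfl, rfl⟩
    revert i k
    refine forall_iff_skip (j := j).2 ⟨fun k hik hki _ => ?_, fun k hik hki _ => ?_, fun i =>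
      forall_iff_skip (j := j).2 ⟨fun _ hki hlt => ?_, fun _ hki hlt => ?_, fun k => ?_⟩⟩
    · rw [insertPair_castSucc] at hki
      exact (Fin.castSucc_lt_iff_succ_le.1 hik).not_gt hki
    · rw [insertPair_succ] at hki
      exact (hik.trans hki).not_gt j.castSucc_lt_succ
    · rw [insertPair_castSucc] at hlt
      exact (Fin.castSucc_lt_iff_succ_le.1 hki).not_gt hlt
    · rw [insertPair_succ] at hlt
      exact (hki.trans hlt).not_gt j.castSucc_lt_succ
    · simp only [insertPair_skip, (strictMono_skip j).lt_iff_lt]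
      exact fun hik hki hlt => a.crossingless ⟨i, k, _, _, hik, hki, hlt, rfl, rfl⟩

lemma exists_matching {N : ℕ} {y : ℕ → P1} (hN : 2 * n ≤ N)
    (h : flag N y (2 * n) = LinearMap.ker (z N ^ n)) :
    ∃ a : Matching n, ∀ i, y (a.s i) = perp (y i) := by
  induction n generalizing y with
  | zero =>
    exact ⟨⟨id, fun i => i.elim0, fun i => i.elim0, fun ⟨i, _⟩ => i.elim0⟩, fun i => i.elim0⟩
  | succ n ih =>
    have hker : LinearMap.ker (z N) ≤ flag N y (2 * (n + 1)) := by
      rw [h, pow_succ]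
      exact LinearMap.ker_le_ker_comp _ _
    obtain ⟨j, hjn, hj⟩ := exists_isShift_add_two (by omega) hN hker
    have hperp : y (j + 1) = perp (y j) := (isShift_arc_iff (IsShift.refl _) (by omega)).1 hj
    obtain ⟨a, ha⟩ := ih (by omega) (flag_removePair_eq_ker hj (by omega) hN h)
    lift j to Fin (2 * n + 1) using by omega
    refine ⟨a.insertPair j, forall_iff_skip (j := j).2 ⟨?_, ?_, fun i => ?_⟩⟩ <;>
      simp only [Matching.insertPair]
    · rw [insertPair_castSucc]
      exact hperp
    · rw [insertPair_succ, Fin.val_succ, hperp, perp_perp]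
      rfl
    · rw [insertPair_skip, ← removePair_apply j y, ← removePair_apply j y]
      exact ha i

end InsertPair

section Components

variable {N n : ℕ}

lemma mem_B_iff {F : Y N (2 * n)} : F ∈ B N n ↔ IsShift N (extend (phi N _ F)) 0 (2 * n) := by
  rw [isShift_zero_iff, ← En_eq_ker_z_pow]
  exact Eq.congr_left (F.L_eq_flag (Fin.last _))

lemma mem_K_iff (hN : 2 * n ≤ N) {a : Matching n} {F : Y N (2 * n)} :
    F ∈ K N a ↔ ∀ i ∈ a.O, IsShift N (extend (phi N _ F)) i (a.s i + 1) := by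
  have hK : F ∈ K N a ↔ F ∈ B N n ∧ ∀ i ∈ a.O, flag N (extend (phi N _ F)) (a.s i + 1) =
      zPre N n (a.d i) (flag N (extend (phi N _ F)) i) := by
    simp only [K, Set.mem_ofPred_eq, F.L_eq_flag, Fin.val_succ, Fin.val_castSucc]
  rw [hK, mem_B_iff]
  set y := extend (phi N _ F)
  constructor
  · rintro ⟨-, hpre⟩ i hi
    have hd := a.s_add_one hi
    have := (a.s i).2
    have hdim := finrank_comap_z_pow (flag_le_ker_z_pow (N := N) y i) (a.d i) (by omega)
    rw [finrank_flag (by omega), ← hd] at hdim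
    refine (isShift_iff hd).2 (Submodule.eq_of_le_of_finrank_eq ?_ ?_)
    · exact (hpre i hi).trans_le inf_le_right
    · rw [hdim, finrank_flag (by omega)]
  · intro hshift
    have hB := a.closedOn_univ.isShift (fun i hi _ => hshift i hi) (Nat.zero_le _) le_rfl
    refine ⟨hB, fun i hi => ?_⟩
    rw [zPre, ← (isShift_iff (a.s_add_one hi)).1 (hshift i hi), En_eq_ker_z_pow,
      ← isShift_zero_iff.1 hB]
    exact (inf_eq_right.2 (flag_mono y (a.s i).2)).symm

lemma I_mem_S_iff {a : Matching n} {l : Fin (2 * n) → P1} :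
    I (2 * n) l ∈ S a ↔ ∀ i ∈ a.O, l (a.s i) = perp (l i) :=
  forall₂_congr fun _ hi => I_apply_eq_I_apply_iff (a.odd_add_s hi)

lemma K_eq_preimage (hN : 2 * n ≤ N) (a : Matching n) :
    K N a = (I (2 * n) ∘ phi N (2 * n)) ⁻¹' S a := by
  ext F
  rw [mem_K_iff hN, forall_isShift_iff hN, Set.mem_preimage, Function.comp_apply, I_mem_S_iff]
  simp only [extend_val]

lemma B_eq_preimage (hN : 2 * n ≤ N) :
    B N n = (I (2 * n) ∘ phi N (2 * n)) ⁻¹' STilde n := by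
  simp only [STilde, Set.preimage_iUnion, ← K_eq_preimage hN]
  ext F
  rw [Set.mem_iUnion]
  refine ⟨fun hF => ?_, fun ⟨_, ha⟩ => ha.1⟩
  obtain ⟨a, ha⟩ := exists_matching hN (isShift_zero_iff.1 (mem_B_iff.1 hF))
  exact ⟨a, (mem_K_iff hN).2 ((forall_isShift_iff hN).2 fun i _ => ha i)⟩

end Components

end Springer

end

theorem proposition2 (N n : ℕ) (hN : 2 * n ≤ N) :
    Springer.IsDiffeo (Springer.flagProj N (2 * n)) (Springer.lineProj (2 * n))
        (Springer.I (2 * n) ∘ Springer.phi N (2 * n)) ∧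
      (∀ a : Springer.Matching n,
        (Springer.I (2 * n) ∘ Springer.phi N (2 * n)) '' Springer.K N a = Springer.S a) ∧
      (Springer.I (2 * n) ∘ Springer.phi N (2 * n)) '' Springer.B N n = Springer.STilde n := by
  have hdiffeo := Springer.isDiffeo_I_phi hN
  refine ⟨hdiffeo, fun a => ?_, ?_⟩
  · rw [Springer.K_eq_preimage hN, Set.image_preimage_eq _ hdiffeo.surjective]
  · rw [Springer.B_eq_preimage hN, Set.image_preimage_eq _ hdiffeo.surjective]
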